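/- Identify operators on two qubits with complex $4\times4$ matrices in the basis $|00\rangle,|01\rangle,|10\rangle,|11\rangle$, and let $Z_\theta=\mathrm{diag}(e^{i\theta/2},e^{-i\theta/2})$. A two-qubit unitary $U$ is a \emph{phase carrier} if for all real $\theta_0,\theta_1$ there are real $\phi_0,\phi_1$ with $U(Z_{\theta_0}\otimes Z_{\theta_1})=(Z_{\phi_0}\otimes Z_{\phi_1})U$. Two-qubit gates $U,V$ are \emph{locally equivalent}, $U\sim V$, if $U=(A\otimes B)V(C\otimes D)$ for some $A,B,C,D\in U(2)$. Let $X,Y,Z$ be the Pauli matrices, and $$\mathrm{CAN}(c_1,c_2,c_3)=\exp\!\Big(\tfrac{i}{2}\,(c_1\,X\otimes X+c_2\,Y\otimes Y+c_3\,Z\otimes Z)\Big).$$ The Weyl chamber is the tetrahedron $\{c\in\mathbb R^3:\ \pi-c_2\ge c_1\ge c_2\ge c_3\ge 0\}$, where of the two points $(c_1,c_2,0)$ and $(\pi-c_1,c_2,0)$ of its base, which represent the same local equivalence class, only the one with $c_1\le\pi/2$ is kept. A point $c$ of the Weyl chamber represents the local equivalence class of $U$ if $U\sim\mathrm{CAN}(c)$.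 Let $\mathrm{CPHASE}(\theta)=\mathrm{diag}(1,1,1,e^{i\theta})$, and call $\mathrm{SWAP}\cdot V$ the mirror of a gate $V$. \textbf{Proposition.} The local equivalence classes of $I$, $\mathrm{CNOT}$, $\mathrm{iSWAP}$, $\mathrm{SWAP}$ are represented by exactly one point of the Weyl chamber each, namely $(0,0,0)$, $(\pi/2,0,0)$, $(\pi/2,\pi/2,0)$, $(\pi/2,\pi/2,\pi/2)$, respectively. The local equivalence class of every two-qubit phase carrier $U\in U(4)$ is represented by exactly one point of the Weyl chamber, and this point lies on the segment from $I$ to $\mathrm{CNOT}$ or on the segment from $\mathrm{iSWAP}$ to $\mathrm{SWAP}$. More precisely, at least one of the following holds: 1. $U$ is locally equivalent to $\mathrm{CPHASE}(\theta)$ for some $\theta\in\mathbb R$, and the point of $U$ is $(x,0,0)$ for some $x\in[0,\pi/2]$; 2. $U$ is locally equivalent to the mirror of $\mathrm{CPHASE}(\theta)$ for some $\theta\in\mathbb R$, and the point of $U$ is $(\pi/2,\pi/2,\pi/2-x)$ for some $x\in[0,\pi/2]$. -/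

import Mathlib

open scoped Kronecker

noncomputable section

namespace TwoQubit

/-- Operators on one qubit, in the computational basis. -/
abbrev Op1 := Matrix (Fin 2) (Fin 2) ℂ

/-- Operators on two qubits, in the computational basis: the pair `(a, b)` is the basis
vector `|a b⟩`, and the tensor product is the Kronecker product. -/
abbrev Op2 := Matrix (Fin 2 × Fin 2) (Fin 2 × Fin 2) ℂ

/-- The Pauli matrices. -/
def pauliX : Op1 := !![0, 1; 1, 0]

def pauliY : Op1 := !![0, -Complex.I; Complex.I, 0]

def pauliZ : Op1 := !![1, 0; 0, -1]

/-- The rotation `Z_θ = diag (e^{iθ/2}, e^{-iθ/2})`. -/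
def rotZ (θ : ℝ) : Op1 :=
  !![Complex.exp (Complex.I * θ / 2), 0; 0, Complex.exp (-(Complex.I * θ / 2))]

/-- `U` is a phase carrier: every pair of `Z` rotations can be carried across `U`. -/
def IsPhaseCarrier (U : Op2) : Prop :=
  ∀ θ₀ θ₁ : ℝ, ∃ φ₀ φ₁ : ℝ, U * (rotZ θ₀ ⊗ₖ rotZ θ₁) = (rotZ φ₀ ⊗ₖ rotZ φ₁) * U

/-- The gate `diag (1, 1, 1, e^{iθ})`. -/
def cphase (θ : ℝ) : Op2 :=
  Matrix.diagonal fun p => if p = (1, 1) then Complex.exp (Complex.I * θ) else 1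

/-- `|a b⟩ ↦ |b a⟩`. -/
def swapGate : Op2 := Matrix.of fun p q => if p = (q.2, q.1) then 1 else 0

/-- `|a b⟩ ↦ |b a⟩` if `a = b`, and `|a b⟩ ↦ i |b a⟩` otherwise. -/
def iswapGate : Op2 :=
  Matrix.of fun p q => if p = (q.2, q.1) then (if q.1 = q.2 then 1 else Complex.I) else 0

/-- `|a b⟩ ↦ |a, a ⊕ b⟩`. -/
def cnotGate : Op2 := Matrix.of fun p q => if p = (q.1, q.1 + q.2) then 1 else 0

/-- The mirror of a two-qubit gate: the gate followed by SWAP. -/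
def mirror (V : Op2) : Op2 := swapGate * V

/-- Local equivalence: equality up to single-qubit unitaries before and after. The single-qubit
unitaries range over `U(2)`, so a global phase is allowed. -/
def LocallyEquivalent (U V : Op2) : Prop :=
  ∃ A ∈ Matrix.unitaryGroup (Fin 2) ℂ, ∃ B ∈ Matrix.unitaryGroup (Fin 2) ℂ,
  ∃ C ∈ Matrix.unitaryGroup (Fin 2) ℂ, ∃ D ∈ Matrix.unitaryGroup (Fin 2) ℂ,
    U = (A ⊗ₖ B) * V * (C ⊗ₖ D)

/-- The canonical gate `exp ((i/2) (c₁ X⊗X + c₂ Y⊗Y + c₃ Z⊗Z))` with interaction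
coefficients `c = (c₁, c₂, c₃)`. -/
def canonicalGate (c : Fin 3 → ℝ) : Op2 :=
  NormedSpace.exp ((Complex.I / 2) •
    ((c 0 : ℂ) • (pauliX ⊗ₖ pauliX) + (c 1 : ℂ) • (pauliY ⊗ₖ pauliY)
      + (c 2 : ℂ) • (pauliZ ⊗ₖ pauliZ)))

/-- The Weyl chamber: the tetrahedron `π - c₂ ≥ c₁ ≥ c₂ ≥ c₃ ≥ 0` with vertices `(0,0,0)`,
`(π,0,0)`, `(π/2,π/2,0)`, `(π/2,π/2,π/2)`. On its base `c₃ = 0` the points `(c₁,c₂,0)` and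
`(π-c₁,c₂,0)` stand for the same local equivalence class; of these two the one with
`c₁ ≤ π/2` is kept. -/
def weylChamber : Set (Fin 3 → ℝ) :=
  {c | c 0 ≤ Real.pi - c 1 ∧ c 1 ≤ c 0 ∧ c 2 ≤ c 1 ∧ 0 ≤ c 2 ∧ (c 2 = 0 → c 0 ≤ Real.pi / 2)}

/-- The points of the Weyl chamber that represent the local equivalence class of `U`. -/
def weylPoints (U : Op2) : Set (Fin 3 → ℝ) :=
  {c | c ∈ weylChamber ∧ LocallyEquivalent U (canonicalGate c)}

end TwoQubit

end

noncomputable section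

namespace TwoQubit

open Matrix

/-! ### Local equivalence -/

/-! Carrying one pair of rotations with four distinct phases already forces U to be monomial. The
phases at p and p + (1,1) are mutually inverse, so the permutation of U preserves antipodes on the
square and is a bit flip, possibly composed with the exchange of qubits
(`IsPhaseCarrier.exists_monomial`). Bit flips are local, hence U is equivalent to a diagonal gate or
its mirror. A diagonal gate is a controlled phase up to local factors, and the angle may be negated,
hence taken as 2x with x in [0, π/2]; its canonical form, and that of its mirror, is explicit.

Uniqueness rests on `makhlin`: local factors only conjugate it and multiply it by a scalar, whose
square is seen by the determinant. For canonical gates the traces of `makhlin` and of its square are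
trigonometric products, compared up to a sign (`invariants_of_locallyEquivalent_canonicalGate`). On
the two edges one coordinate is forced at once, and the others follow from a factored identity
between squares. -/

theorem LocallyEquivalent.symm {U V : Op2} (h : LocallyEquivalent U V) :
    LocallyEquivalent V U := by
  obtain ⟨A, hA, B, hB, C, hC, D, hD, rfl⟩ := h
  refine ⟨star A, Unitary.star_mem hA, star B, Unitary.star_mem hB, star C, Unitary.star_mem hC,
    star D, Unitary.star_mem hD, ?_⟩
  have h1 : (star A ⊗ₖ star B) * (A ⊗ₖ B) = 1 := by
    rw [← mul_kronecker_mul, mem_unitaryGroup_iff'.1 hA, mem_unitaryGroup_iff'.1 hB,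
      one_kronecker_one]
  have h2 : (C ⊗ₖ D) * (star C ⊗ₖ star D) = 1 := by
    rw [← mul_kronecker_mul, mem_unitaryGroup_iff.1 hC, mem_unitaryGroup_iff.1 hD,
      one_kronecker_one]
  calc V = ((star A ⊗ₖ star B) * (A ⊗ₖ B)) * V * ((C ⊗ₖ D) * (star C ⊗ₖ star D)) := by
        rw [h1, h2, one_mul, mul_one]
    _ = _ := by simp only [mul_assoc]

theorem LocallyEquivalent.trans {U V W : Op2} (h : LocallyEquivalent U V)
    (h' : LocallyEquivalent V W) : LocallyEquivalent U W := by
  obtain ⟨A, hA, B, hB, C, hC, D, hD, rfl⟩ := h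
  obtain ⟨A', hA', B', hB', C', hC', D', hD', rfl⟩ := h'
  refine ⟨A * A', mul_mem hA hA', B * B', mul_mem hB hB', C' * C, mul_mem hC' hC,
    D' * D, mul_mem hD' hD, ?_⟩
  simp only [mul_kronecker_mul, mul_assoc]

theorem LocallyEquivalent.weylPoints_eq {U V : Op2} (h : LocallyEquivalent U V) :
    weylPoints U = weylPoints V := by
  ext c
  exact and_congr_right fun _ => ⟨h.symm.trans, h.trans⟩

theorem swapGate_mul_apply (V : Op2) (p q : Fin 2 × Fin 2) :
    (swapGate * V) p q = V p.swap q := by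
  obtain ⟨i, j⟩ := p
  fin_cases i <;> fin_cases j <;>
    simp [swapGate, mul_apply, Fintype.sum_prod_type]

theorem swapGate_mul_kronecker (A B : Op1) :
    swapGate * (A ⊗ₖ B) = (B ⊗ₖ A) * swapGate := by
  ext ⟨i, j⟩ ⟨k, l⟩
  rw [swapGate_mul_apply]
  fin_cases k <;> fin_cases l <;>
    simp [swapGate, mul_apply, mul_comm]

theorem LocallyEquivalent.mirror {U V : Op2} (h : LocallyEquivalent U V) :
    LocallyEquivalent (mirror U) (mirror V) := by
  obtain ⟨A, hA, B, hB, C, hC, D, hD, rfl⟩ := h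
  refine ⟨B, hB, A, hA, C, hC, D, hD, ?_⟩
  simp only [TwoQubit.mirror, ← mul_assoc, swapGate_mul_kronecker]

theorem pauliX_mem_unitaryGroup : pauliX ∈ unitaryGroup (Fin 2) ℂ := by
  rw [mem_unitaryGroup_iff]
  ext i j
  fin_cases i <;> fin_cases j <;> simp [pauliX, mul_apply, star_apply]

theorem diagonal_mem_unitaryGroup {n : Type*} [Fintype n] [DecidableEq n] {d : n → ℂ}
    (h : ∀ i, ‖d i‖ = 1) : diagonal d ∈ unitaryGroup n ℂ := by
  rw [mem_unitaryGroup_iff, star_eq_conjTranspose, diagonal_conjTranspose, diagonal_mul_diagonal,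
    ← diagonal_one]
  congr 1
  ext i
  simp [Complex.mul_conj, Complex.normSq_eq_norm_sq, h]

/-- The Hadamard gate. -/
def hadamard : Op1 :=
  !![((√2 : ℝ) : ℂ)⁻¹, ((√2 : ℝ) : ℂ)⁻¹; ((√2 : ℝ) : ℂ)⁻¹, -((√2 : ℝ) : ℂ)⁻¹]

theorem inv_sqrt_two_mul_self : ((√2 : ℝ) : ℂ)⁻¹ * ((√2 : ℝ) : ℂ)⁻¹ = 1 / 2 := by
  rw [← mul_inv, ← Complex.ofReal_mul, Real.mul_self_sqrt (by norm_num)]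
  norm_num

theorem hadamard_mul_self : hadamard * hadamard = 1 := by
  ext i j
  fin_cases i <;> fin_cases j <;>
    simp [hadamard, mul_apply, inv_sqrt_two_mul_self] <;> norm_num

theorem hadamard_mem_unitaryGroup : hadamard ∈ unitaryGroup (Fin 2) ℂ := by
  have : star hadamard = hadamard := by
    ext i j
    fin_cases i <;> fin_cases j <;> simp [hadamard, star_apply]
  rw [mem_unitaryGroup_iff, this, hadamard_mul_self]

/-! ### Diagonal gates -/

/-- A diagonal gate is determined up to local equivalence by the cross ratio of its entries. -/
theorem locallyEquivalent_cphase_of_cross_ratio {d : Fin 2 × Fin 2 → ℂ} (hd : ∀ p, ‖d p‖ = 1)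
    {θ : ℝ} (hθ : d (0, 0) * d (1, 1) = Complex.exp (Complex.I * θ) * (d (0, 1) * d (1, 0))) :
    LocallyEquivalent (diagonal d) (cphase θ) := by
  have h0 : ∀ p, d p ≠ 0 := fun p h => by simpa [h] using hd p
  -- These factors match the entries with a zero index; the cross ratio remains at (1,1).
  refine ⟨diagonal fun i => d (i, 0), diagonal_mem_unitaryGroup fun i => hd _,
    diagonal fun j => d (0, j) / d (0, 0), diagonal_mem_unitaryGroup fun j => by simp [hd],
    1, one_mem _, 1, one_mem _, ?_⟩
  rw [one_kronecker_one, mul_one, diagonal_kronecker_diagonal, cphase, diagonal_mul_diagonal]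
  congr 1
  ext ⟨i, j⟩
  have := h0 (0, 0)
  fin_cases i <;> fin_cases j <;> simp <;> field_simp
  linear_combination hθ

theorem norm_exp_I_mul (x : ℝ) : ‖Complex.exp (Complex.I * x)‖ = 1 := by
  rw [mul_comm, Complex.norm_exp_ofReal_mul_I]

theorem exists_exp_eq_of_norm_eq_one {z : ℂ} (hz : ‖z‖ = 1) :
    ∃ θ : ℝ, Complex.exp (Complex.I * θ) = z :=
  ⟨z.arg, by simpa [hz, mul_comm] using Complex.norm_mul_exp_arg_mul_I z⟩

theorem exists_locallyEquivalent_cphase {d : Fin 2 × Fin 2 → ℂ} (hd : ∀ p, ‖d p‖ = 1) :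
    ∃ θ : ℝ, LocallyEquivalent (diagonal d) (cphase θ) := by
  have h0 : ∀ p, d p ≠ 0 := fun p h => by simpa [h] using hd p
  obtain ⟨θ, hθ⟩ := exists_exp_eq_of_norm_eq_one
    (z := d (0, 0) * d (1, 1) / (d (0, 1) * d (1, 0))) (by simp [hd])
  refine ⟨θ, locallyEquivalent_cphase_of_cross_ratio hd ?_⟩
  rw [hθ]
  have := h0 (0, 1)
  have := h0 (1, 0)
  field_simp

/-- Conjugating by X on the first qubit moves the phase to (0,1), which inverts the cross ratio. -/
theorem cphase_locallyEquivalent_neg (θ : ℝ) :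
    LocallyEquivalent (cphase θ) (cphase (-θ)) := by
  have h : LocallyEquivalent (cphase θ) (diagonal fun p : Fin 2 × Fin 2 =>
      if p = (0, 1) then Complex.exp (Complex.I * θ) else 1) := by
    refine ⟨pauliX, pauliX_mem_unitaryGroup, 1, one_mem _, pauliX, pauliX_mem_unitaryGroup,
      1, one_mem _, ?_⟩
    ext ⟨i, j⟩ ⟨k, l⟩
    fin_cases i <;> fin_cases j <;> fin_cases k <;> fin_cases l <;>
      simp [cphase, pauliX, mul_apply, Fintype.sum_prod_type, diagonal_apply, one_apply]
  refine h.trans (locallyEquivalent_cphase_of_cross_ratio (fun p => ?_) ?_)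
  · split_ifs <;> simp
  · simp [← Complex.exp_add]

/-- Every controlled phase gate is locally equivalent to one with angle in `[0, π]`. -/
theorem exists_cphase_locallyEquivalent (θ : ℝ) :
    ∃ x ∈ Set.Icc (0 : ℝ) (Real.pi / 2), LocallyEquivalent (cphase θ) (cphase (2 * x)) := by
  set a := (Complex.exp (Complex.I * θ)).arg with ha
  have h1 : cphase θ = cphase a := by
    have := Complex.norm_mul_exp_arg_mul_I (Complex.exp (Complex.I * θ))
    rw [norm_exp_I_mul, Complex.ofReal_one, one_mul, ← ha, mul_comm] at this
    simp only [cphase, this]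
  have hle : |a| ≤ Real.pi := Complex.abs_arg_le_pi _
  refine ⟨|a| / 2, ⟨by positivity, by linarith⟩, ?_⟩
  rw [h1, mul_div_cancel₀ _ two_ne_zero]
  rcases abs_choice a with h | h <;> rw [h]
  · exact ⟨1, one_mem _, 1, one_mem _, 1, one_mem _, 1, one_mem _, by simp⟩
  · exact cphase_locallyEquivalent_neg a

/-! ### The canonical gate in the Bell basis -/

/-- The matrix whose columns are `√2` times the Bell states. -/
def bell : Op2 := Matrix.of fun p q =>
  !![1, 0, 0, 1; 0, 1, 1, 0; 0, 1, -1, 0; 1, 0, 0, -1]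
    (finProdFinEquiv p : Fin 4) (finProdFinEquiv q : Fin 4)

theorem bell_mul_bell : bell * bell = (2 : ℂ) • 1 := by
  ext ⟨i, j⟩ ⟨k, l⟩
  fin_cases i <;> fin_cases j <;> fin_cases k <;> fin_cases l <;>
    simp [bell, mul_apply, Fintype.sum_prod_type, finProdFinEquiv, one_apply] <;> norm_num

theorem bell_transpose : bellᵀ = bell := by
  ext ⟨i, j⟩ ⟨k, l⟩
  fin_cases i <;> fin_cases j <;> fin_cases k <;> fin_cases l <;>
    simp [bell, finProdFinEquiv]

/-- The eigenvalues of `c₁ X⊗X + c₂ Y⊗Y + c₃ Z⊗Z` on the Bell states. -/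
def bellEnergy (c : Fin 3 → ℝ) (p : Fin 2 × Fin 2) : ℝ :=
  ![c 0 - c 1 + c 2, c 0 + c 1 - c 2, -c 0 - c 1 - c 2, -c 0 + c 1 + c 2]
    (finProdFinEquiv p : Fin 4)

/-- The Bell states are common eigenvectors of the three commuting Pauli products. -/
theorem hamiltonian_eq (c : Fin 3 → ℝ) :
    (Complex.I / 2) • ((c 0 : ℂ) • (pauliX ⊗ₖ pauliX) + (c 1 : ℂ) • (pauliY ⊗ₖ pauliY)
      + (c 2 : ℂ) • (pauliZ ⊗ₖ pauliZ)) =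
    bell * diagonal (fun p => Complex.I / 2 * bellEnergy c p) * bell⁻¹ := by
  have hinv : bell⁻¹ = (1 / 2 : ℂ) • bell := by
    apply inv_eq_right_inv
    rw [mul_smul_comm, bell_mul_bell, smul_smul]
    norm_num
  rw [hinv]
  ext ⟨i, j⟩ ⟨k, l⟩
  fin_cases i <;> fin_cases j <;> fin_cases k <;> fin_cases l <;>
    simp [bell, mul_apply, Fintype.sum_prod_type, finProdFinEquiv, diagonal_apply,
      bellEnergy, pauliX, pauliY, pauliZ] <;> ring_nf

theorem canonicalGate_eq (c : Fin 3 → ℝ) :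
    canonicalGate c = (1 / 2 : ℂ) •
      (bell * diagonal (fun p => Complex.exp (Complex.I / 2 * bellEnergy c p)) * bell) := by
  have hr : bell * ((1 / 2 : ℂ) • bell) = 1 := by
    rw [mul_smul_comm, bell_mul_bell, smul_smul]
    norm_num
  have hu : IsUnit bell := (isUnit_iff_isUnit_det _).2 (isUnit_det_of_right_inverse hr)
  rw [canonicalGate, hamiltonian_eq, exp_conj _ _ hu, exp_diagonal, inv_eq_right_inv hr,
    mul_smul_comm]
  congr 4
  ext p
  rw [Complex.exp_eq_exp_ℂ, Pi.coe_exp]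

theorem pauliY_kronecker_pauliY : pauliY ⊗ₖ pauliY = (1 / 2 : ℂ) •
    (bell * diagonal (fun p => if p.2 = 0 then -1 else 1) * bell) := by
  ext ⟨i, j⟩ ⟨k, l⟩
  fin_cases i <;> fin_cases j <;> fin_cases k <;> fin_cases l <;>
    simp [bell, mul_apply, Fintype.sum_prod_type, finProdFinEquiv, diagonal_apply,
      pauliY] <;> norm_num

theorem bellForm_mul (d e : Fin 2 × Fin 2 → ℂ) :
    ((1 / 2 : ℂ) • (bell * diagonal d * bell)) * ((1 / 2 : ℂ) • (bell * diagonal e * bell)) =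
      (1 / 2 : ℂ) • (bell * diagonal (fun p => d p * e p) * bell) := by
  have : bell * diagonal d * bell * (bell * diagonal e * bell) =
      (2 : ℂ) • (bell * diagonal (fun p => d p * e p) * bell) := by
    calc _ = bell * diagonal d * (bell * bell) * diagonal e * bell := by simp only [mul_assoc]
      _ = _ := by
        rw [bell_mul_bell, mul_smul_comm, mul_one, smul_mul_assoc, smul_mul_assoc,
          mul_assoc bell, diagonal_mul_diagonal]
  rw [smul_mul_smul_comm, this, smul_smul]
  norm_num

theorem bellForm_trace (d : Fin 2 × Fin 2 → ℂ) :
    ((1 / 2 : ℂ) • (bell * diagonal d * bell)).trace = ∑ p, d p := by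
  rw [trace_smul, trace_mul_comm, ← mul_assoc, bell_mul_bell, smul_mul_assoc, one_mul,
    trace_smul, smul_smul, trace_diagonal]
  norm_num

theorem bellForm_det (d : Fin 2 × Fin 2 → ℂ) :
    ((1 / 2 : ℂ) • (bell * diagonal d * bell)).det = ∏ p, d p := by
  have h := congrArg det bell_mul_bell
  rw [det_mul, det_smul, det_one] at h
  rw [det_smul, det_mul, det_mul, det_diagonal, mul_right_comm, h]
  simp

/-! ### Local invariants -/

/-- The matrix whose spectrum, up to a global sign, is the complete local invariant. -/
def makhlin (U : Op2) : Op2 := U * (pauliY ⊗ₖ pauliY) * Uᵀ * (pauliY ⊗ₖ pauliY)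

/-- Up to a scalar, Y is the symplectic form on ℂ², which every matrix preserves up to its
determinant. -/
theorem mul_pauliY_mul_transpose (A : Op1) : A * pauliY * Aᵀ = A.det • pauliY := by
  ext i j
  fin_cases i <;> fin_cases j <;>
    simp [pauliY, mul_apply, det_fin_two] <;> ring

theorem kronecker_mul_pauliY_mul_transpose (A B : Op1) :
    (A ⊗ₖ B) * (pauliY ⊗ₖ pauliY) * (A ⊗ₖ B)ᵀ = (A.det * B.det) • (pauliY ⊗ₖ pauliY) := by
  rw [← kroneckerMap_transpose, ← mul_kronecker_mul, ← mul_kronecker_mul,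
    mul_pauliY_mul_transpose, mul_pauliY_mul_transpose, smul_kronecker, kronecker_smul, smul_smul]

/-- The right factors C, D collapse to a scalar against Y ⊗ Y, while moving the transpose of A ⊗ B
past Y ⊗ Y turns it into an inverse. -/
theorem makhlin_conj {A B : Op1} (hA : A ∈ unitaryGroup (Fin 2) ℂ)
    (hB : B ∈ unitaryGroup (Fin 2) ℂ) (V : Op2) (C D : Op1) :
    makhlin ((A ⊗ₖ B) * V * (C ⊗ₖ D)) = (A.det * B.det * (C.det * D.det)) •
      ((A ⊗ₖ B) * makhlin V * (star A ⊗ₖ star B)) := by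
  have h1 : (A ⊗ₖ B) * (star A ⊗ₖ star B) = 1 := by
    rw [← mul_kronecker_mul, mem_unitaryGroup_iff.1 hA, mem_unitaryGroup_iff.1 hB,
      one_kronecker_one]
  have h2 : (A ⊗ₖ B)ᵀ * (pauliY ⊗ₖ pauliY) =
      (A.det * B.det) • ((pauliY ⊗ₖ pauliY) * (star A ⊗ₖ star B)) := by
    have h := kronecker_mul_pauliY_mul_transpose Aᵀ Bᵀ
    rw [kroneckerMap_transpose, transpose_transpose, det_transpose, det_transpose] at h
    rw [← smul_mul_assoc, ← h, mul_assoc _ (A ⊗ₖ B), h1, mul_one]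
  have h3 := kronecker_mul_pauliY_mul_transpose C D
  unfold makhlin
  calc _ = (A ⊗ₖ B) * V * ((C ⊗ₖ D) * (pauliY ⊗ₖ pauliY) * (C ⊗ₖ D)ᵀ) * Vᵀ *
        ((A ⊗ₖ B)ᵀ * (pauliY ⊗ₖ pauliY)) := by
        simp only [transpose_mul, mul_assoc]
    _ = _ := by
        rw [h3, h2]
        simp only [mul_smul_comm, smul_mul_assoc, smul_smul, mul_assoc]

theorem LocallyEquivalent.exists_invariants {U V : Op2} (h : LocallyEquivalent U V) :
    ∃ z : ℂ, U.det = z ^ 2 * V.det ∧ (makhlin U).trace = z * (makhlin V).trace ∧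
      (makhlin U * makhlin U).trace = z ^ 2 * (makhlin V * makhlin V).trace := by
  obtain ⟨A, hA, B, hB, C, hC, D, hD, rfl⟩ := h
  have h1 : (star A ⊗ₖ star B) * (A ⊗ₖ B) = 1 := by
    rw [← mul_kronecker_mul, mem_unitaryGroup_iff'.1 hA, mem_unitaryGroup_iff'.1 hB,
      one_kronecker_one]
  refine ⟨A.det * B.det * (C.det * D.det), ?_, ?_, ?_⟩
  · simp only [det_mul, det_kronecker, Fintype.card_fin]
    ring
  · rw [makhlin_conj hA hB, trace_smul, trace_mul_comm, ← mul_assoc (star A ⊗ₖ star B), h1,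
      one_mul, smul_eq_mul]
  · rw [makhlin_conj hA hB, smul_mul_smul_comm, trace_smul, smul_eq_mul, ← sq]
    congr 1
    rw [show (A ⊗ₖ B) * makhlin V * (star A ⊗ₖ star B) *
        ((A ⊗ₖ B) * makhlin V * (star A ⊗ₖ star B)) = (A ⊗ₖ B) * makhlin V *
          ((star A ⊗ₖ star B) * (A ⊗ₖ B)) * makhlin V * (star A ⊗ₖ star B) by
        simp only [mul_assoc], h1, mul_one, trace_mul_comm, ← mul_assoc, ← mul_assoc,
      h1, one_mul]

theorem det_canonicalGate (c : Fin 3 → ℝ) : (canonicalGate c).det = 1 := by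
  rw [canonicalGate_eq, bellForm_det, ← Complex.exp_sum, ← Finset.mul_sum]
  simp [Fintype.sum_prod_type, bellEnergy, finProdFinEquiv]

theorem makhlin_canonicalGate (c : Fin 3 → ℝ) :
    makhlin (canonicalGate c) = (1 / 2 : ℂ) •
      (bell * diagonal (fun p => Complex.exp (Complex.I * bellEnergy c p)) * bell) := by
  have ht : (canonicalGate c)ᵀ = canonicalGate c := by
    rw [canonicalGate_eq, transpose_smul, transpose_mul, transpose_mul, diagonal_transpose,
      bell_transpose, mul_assoc]
  rw [makhlin, ht, canonicalGate_eq, pauliY_kronecker_pauliY, bellForm_mul, bellForm_mul,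
    bellForm_mul]
  congr 4
  ext p
  have : Complex.exp (Complex.I * bellEnergy c p) =
      Complex.exp (Complex.I / 2 * bellEnergy c p) * Complex.exp (Complex.I / 2 * bellEnergy c p) := by
    rw [← Complex.exp_add]
    ring_nf
  rw [this]
  split_ifs <;> ring

theorem sum_exp_bellEnergy (c : Fin 3 → ℝ) :
    ∑ p, Complex.exp (Complex.I * bellEnergy c p) =
      4 * ((Real.cos (c 0) * Real.cos (c 1) * Real.cos (c 2) : ℝ) +
        (Real.sin (c 0) * Real.sin (c 1) * Real.sin (c 2) : ℝ) * Complex.I) := by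
  simp only [mul_comm Complex.I, Complex.exp_mul_I]
  simp [Fintype.sum_prod_type, bellEnergy, finProdFinEquiv, sub_eq_add_neg, Complex.cos_add,
    Complex.sin_add]
  ring

theorem trace_makhlin_canonicalGate (c : Fin 3 → ℝ) :
    (makhlin (canonicalGate c)).trace =
      4 * ((Real.cos (c 0) * Real.cos (c 1) * Real.cos (c 2) : ℝ) +
        (Real.sin (c 0) * Real.sin (c 1) * Real.sin (c 2) : ℝ) * Complex.I) := by
  rw [makhlin_canonicalGate, bellForm_trace, sum_exp_bellEnergy]

theorem trace_makhlin_sq_canonicalGate (c : Fin 3 → ℝ) :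
    (makhlin (canonicalGate c) * makhlin (canonicalGate c)).trace =
      4 * ((Real.cos (2 * c 0) * Real.cos (2 * c 1) * Real.cos (2 * c 2) : ℝ) +
        (Real.sin (2 * c 0) * Real.sin (2 * c 1) * Real.sin (2 * c 2) : ℝ) * Complex.I) := by
  rw [makhlin_canonicalGate, bellForm_mul, bellForm_trace]
  -- Squaring doubles the eigenphases, so the previous trace formula applies at 2c.
  have := sum_exp_bellEnergy fun i => 2 * c i
  rw [← this]
  refine Finset.sum_congr rfl fun p _ => ?_
  rw [← Complex.exp_add]
  congr 1
  obtain ⟨i, j⟩ := p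
  fin_cases i <;> fin_cases j <;> simp [bellEnergy, finProdFinEquiv] <;> ring

theorem invariants_of_locallyEquivalent_canonicalGate {c c' : Fin 3 → ℝ}
    (h : LocallyEquivalent (canonicalGate c) (canonicalGate c')) :
    ∃ ε : ℝ, (ε = 1 ∨ ε = -1) ∧
      Real.cos (c 0) * Real.cos (c 1) * Real.cos (c 2) =
        ε * (Real.cos (c' 0) * Real.cos (c' 1) * Real.cos (c' 2)) ∧
      Real.sin (c 0) * Real.sin (c 1) * Real.sin (c 2) =
        ε * (Real.sin (c' 0) * Real.sin (c' 1) * Real.sin (c' 2)) ∧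
      Real.cos (2 * c 0) * Real.cos (2 * c 1) * Real.cos (2 * c 2) =
        Real.cos (2 * c' 0) * Real.cos (2 * c' 1) * Real.cos (2 * c' 2) := by
  obtain ⟨z, h1, h2, h3⟩ := h.exists_invariants
  rw [det_canonicalGate, det_canonicalGate, mul_one] at h1
  rw [trace_makhlin_canonicalGate, trace_makhlin_canonicalGate] at h2
  rw [trace_makhlin_sq_canonicalGate, trace_makhlin_sq_canonicalGate, ← h1,
    ← Complex.ofReal_one] at h3
  -- Both determinants are 1, so the scalar is a sign.
  obtain ⟨ε, hε, rfl⟩ : ∃ ε : ℝ, (ε = 1 ∨ ε = -1) ∧ z = ε := by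
    rcases sq_eq_one_iff.1 h1.symm with rfl | rfl
    · exact ⟨1, .inl rfl, by simp⟩
    · exact ⟨-1, .inr rfl, by simp⟩
  have key : ∀ {a b a' b' e : ℝ}, (4 * (a + b * Complex.I) : ℂ) = e * (4 * (a' + b' * Complex.I)) →
      a = e * a' ∧ b = e * b' := by
    intro a b a' b' e h
    have hre := congrArg Complex.re h
    have him := congrArg Complex.im h
    simp at hre him
    constructor <;> linarith
  refine ⟨ε, hε, (key h2).1, (key h2).2, ?_⟩
  rw [(key h3).1, one_mul]

/-! ### Uniqueness of the representing point -/

theorem eq_of_locallyEquivalent_canonicalGate_cnot_edge {c : Fin 3 → ℝ} {x : ℝ}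
    (hc : c ∈ weylChamber) (hx : x ∈ Set.Icc 0 (Real.pi / 2))
    (h : LocallyEquivalent (canonicalGate c) (canonicalGate ![x, 0, 0])) : c = ![x, 0, 0] := by
  obtain ⟨ε, hε, h1, h2, h3⟩ := invariants_of_locallyEquivalent_canonicalGate h
  obtain ⟨ha, hb, hd, he, hf⟩ := hc
  obtain ⟨hx0, hx1⟩ := hx
  have hpi := Real.pi_pos
  simp at h1 h2 h3
  -- The sine product vanishes on this edge, but not in the chamber when c 2 > 0.
  have hc2 : c 2 = 0 := by
    by_contra hne
    have : 0 < c 2 := lt_of_le_of_ne he (Ne.symm hne)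
    have p0 := Real.sin_pos_of_pos_of_lt_pi (x := c 0) (by linarith) (by linarith)
    have p1 := Real.sin_pos_of_pos_of_lt_pi (x := c 1) (by linarith) (by linarith)
    have p2 := Real.sin_pos_of_pos_of_lt_pi (x := c 2) (by linarith) (by linarith)
    rcases h2 with (h2 | h2) | h2 <;> linarith
  have hc0 := hf hc2
  rw [hc2, Real.cos_zero, mul_one] at h1
  rw [hc2, mul_zero, Real.cos_zero, mul_one, Real.cos_two_mul, Real.cos_two_mul,
    Real.cos_two_mul] at h3
  have hsq : (Real.cos (c 0) * Real.cos (c 1)) ^ 2 = Real.cos x ^ 2 := by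
    rw [h1]
    rcases hε with rfl | rfl <;> ring
  have hle : Real.cos (c 0) ≤ Real.cos (c 1) :=
    Real.cos_le_cos_of_nonneg_of_le_pi (by linarith) (by linarith) hb
  have hn0 : 0 ≤ Real.cos (c 0) := Real.cos_nonneg_of_mem_Icc ⟨by linarith, by linarith⟩
  have hcos1 : Real.cos (c 1) = 1 := by
    -- With a, b the squared cosines, ab = cos² x and (2a - 1)(2b - 1) = 2 cos² x - 1 combine to
    -- this factorization.
    have h4 : (1 - Real.cos (c 0) ^ 2) * (1 - Real.cos (c 1) ^ 2) = 0 := by nlinarith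
    have h5 := Real.cos_le_one (c 1)
    rcases mul_eq_zero.1 h4 with h4 | h4 <;> nlinarith
  have hc1 : c 1 = 0 := Real.injOn_cos ⟨by linarith, by linarith⟩ ⟨le_rfl, hpi.le⟩
    (by rw [hcos1, Real.cos_zero])
  have hc0x : c 0 = x := by
    refine Real.injOn_cos ⟨by linarith, by linarith⟩ ⟨hx0, by linarith⟩ ?_
    have := Real.cos_nonneg_of_mem_Icc (x := x) ⟨by linarith, by linarith⟩
    rw [hcos1, mul_one] at hsq
    exact (sq_eq_sq₀ hn0 this).1 hsq
  ext i
  fin_cases i <;> simp [hc0x, hc1, hc2]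

theorem eq_of_locallyEquivalent_canonicalGate_swap_edge {c : Fin 3 → ℝ} {x : ℝ}
    (hc : c ∈ weylChamber) (hx : x ∈ Set.Icc 0 (Real.pi / 2))
    (h : LocallyEquivalent (canonicalGate c)
      (canonicalGate ![Real.pi / 2, Real.pi / 2, Real.pi / 2 - x])) :
    c = ![Real.pi / 2, Real.pi / 2, Real.pi / 2 - x] := by
  obtain ⟨ε, hε, h1, h2, h3⟩ := invariants_of_locallyEquivalent_canonicalGate h
  obtain ⟨ha, hb, hd, he, hf⟩ := hc
  obtain ⟨hx0, hx1⟩ := hx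
  have hpi := Real.pi_pos
  simp [mul_div_cancel₀, Real.sin_pi_div_two_sub, mul_sub, Real.cos_pi_sub] at h1 h2 h3
  have hc0 : c 0 = Real.pi / 2 := by
    have hz : ∀ y, 0 ≤ y → y ≤ Real.pi → Real.cos y = 0 → y = Real.pi / 2 := fun y h0 h1 h =>
      Real.injOn_cos ⟨h0, h1⟩ ⟨by linarith, by linarith⟩ (by rw [h, Real.cos_pi_div_two])
    -- The chamber inequalities force c 0 = π/2 as soon as any coordinate is π/2. The rest mirrors
    -- the other edge, with sines for cosines.
    rcases h1 with (h1 | h1) | h1 <;>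
      have := hz _ (by linarith) (by linarith) h1 <;> linarith
  rw [hc0, Real.sin_pi_div_two, one_mul] at h2
  rw [hc0, mul_div_cancel₀ _ two_ne_zero, Real.cos_pi, Real.cos_two_mul, Real.cos_two_mul,
    Real.cos_two_mul] at h3
  have hsq : (Real.sin (c 1) * Real.sin (c 2)) ^ 2 = Real.cos x ^ 2 := by
    rw [h2]
    rcases hε with rfl | rfl <;> ring
  have hle : Real.sin (c 2) ≤ Real.sin (c 1) :=
    Real.sin_le_sin_of_le_of_le_pi_div_two (by linarith) (by linarith) hd
  have hn2 : 0 ≤ Real.sin (c 2) := Real.sin_nonneg_of_nonneg_of_le_pi he (by linarith)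
  have hsin1 : Real.sin (c 1) = 1 := by
    rw [Real.cos_sq', Real.cos_sq' (c 2)] at h3
    have h4 : (1 - Real.sin (c 1) ^ 2) * (1 - Real.sin (c 2) ^ 2) = 0 := by nlinarith
    have h5 := Real.sin_le_one (c 1)
    rcases mul_eq_zero.1 h4 with h4 | h4 <;> nlinarith
  have hc1 : c 1 = Real.pi / 2 := Real.injOn_sin ⟨by linarith, by linarith⟩
    ⟨by linarith, le_rfl⟩ (by rw [hsin1, Real.sin_pi_div_two])
  have hc2 : c 2 = Real.pi / 2 - x := by
    refine Real.injOn_sin ⟨by linarith, by linarith⟩ ⟨by linarith, by linarith⟩ ?_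
    have := Real.cos_nonneg_of_mem_Icc (x := x) ⟨by linarith, by linarith⟩
    rw [hsin1, one_mul] at hsq
    rw [Real.sin_pi_div_two_sub]
    exact (sq_eq_sq₀ hn2 this).1 hsq
  ext i
  fin_cases i <;> simp [hc0, hc1, hc2]

/-! ### Controlled phase gates and their mirrors as canonical gates -/

theorem canonicalGate_locallyEquivalent_zz (x : ℝ) :
    LocallyEquivalent (canonicalGate ![x, 0, 0]) (canonicalGate ![0, 0, x]) := by
  refine ⟨hadamard, hadamard_mem_unitaryGroup, hadamard, hadamard_mem_unitaryGroup,
    hadamard, hadamard_mem_unitaryGroup, hadamard, hadamard_mem_unitaryGroup, ?_⟩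
  have hK : (hadamard ⊗ₖ hadamard) * (hadamard ⊗ₖ hadamard) = 1 := by
    rw [← mul_kronecker_mul, hadamard_mul_self, one_kronecker_one]
  have hu : IsUnit (hadamard ⊗ₖ hadamard) :=
    (isUnit_iff_isUnit_det _).2 (isUnit_det_of_right_inverse hK)
  have hX : hadamard * pauliZ * hadamard = pauliX := by
    ext i j
    fin_cases i <;> fin_cases j <;>
      simp [hadamard, pauliX, pauliZ, mul_apply, inv_sqrt_two_mul_self] <;> norm_num
  have hXX : pauliX ⊗ₖ pauliX =
      (hadamard ⊗ₖ hadamard) * (pauliZ ⊗ₖ pauliZ) * (hadamard ⊗ₖ hadamard) := by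
    rw [← mul_kronecker_mul, ← mul_kronecker_mul, hX]
  have h := exp_conj (hadamard ⊗ₖ hadamard)
    ((Complex.I / 2) • ((x : ℂ) • (pauliZ ⊗ₖ pauliZ))) hu
  rw [inv_eq_right_inv hK] at h
  simpa [canonicalGate, hXX] using h

theorem canonicalGate_zz (x : ℝ) : canonicalGate ![0, 0, x] =
    diagonal fun p => Complex.exp (Complex.I * (if p.1 = p.2 then x / 2 else -(x / 2) : ℝ)) := by
  rw [canonicalGate_eq]
  ext ⟨i, j⟩ ⟨k, l⟩
  fin_cases i <;> fin_cases j <;> fin_cases k <;> fin_cases l <;>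
    simp [bell, mul_apply, Fintype.sum_prod_type, finProdFinEquiv, diagonal_apply,
      bellEnergy] <;> ring_nf

theorem canonicalGate_cnot_edge_locallyEquivalent (x : ℝ) :
    LocallyEquivalent (canonicalGate ![x, 0, 0]) (cphase (2 * x)) := by
  refine (canonicalGate_locallyEquivalent_zz x).trans ?_
  rw [canonicalGate_zz]
  refine locallyEquivalent_cphase_of_cross_ratio (fun p => norm_exp_I_mul _) ?_
  simp [← Complex.exp_add]
  ring_nf

/-- The two even Bell states share a phase and the two odd ones have opposite phases, so the even
block is diagonal and the odd block antidiagonal. -/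
theorem canonicalGate_swap_edge (x : ℝ) :
    canonicalGate ![Real.pi / 2, Real.pi / 2, x] = mirror (diagonal fun p =>
      Complex.exp (Complex.I * (if p.1 = p.2 then x / 2 else Real.pi / 2 - x / 2 : ℝ))) := by
  rw [canonicalGate_eq, mirror]
  have h1 : Complex.exp (Complex.I / 2 * (Real.pi - x)) =
      Complex.exp (Complex.I * (Real.pi / 2 - x / 2)) := by ring_nf
  have h2 : Complex.exp (Complex.I / 2 * (-(Real.pi : ℂ) - x)) =
      -Complex.exp (Complex.I * (Real.pi / 2 - x / 2)) := by
    rw [← Complex.exp_sub_pi_mul_I]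
    ring_nf
  have h3 : Complex.exp (Complex.I / 2 * x) = Complex.exp (Complex.I * (x / 2)) := by ring_nf
  have hd : (fun p => Complex.exp (Complex.I / 2 *
      bellEnergy ![Real.pi / 2, Real.pi / 2, x] p)) = fun p : Fin 2 × Fin 2 =>
      ![Complex.exp (Complex.I * (x / 2)), Complex.exp (Complex.I * (Real.pi / 2 - x / 2)),
        -Complex.exp (Complex.I * (Real.pi / 2 - x / 2)), Complex.exp (Complex.I * (x / 2))]
        (finProdFinEquiv p : Fin 4) := by
    ext ⟨i, j⟩
    fin_cases i <;> fin_cases j <;> simp [bellEnergy, finProdFinEquiv, h3]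
    · rw [← h1]
    · rw [← h2]; ring_nf
  rw [hd]
  ext ⟨i, j⟩ ⟨k, l⟩
  rw [swapGate_mul_apply]
  fin_cases i <;> fin_cases j <;> fin_cases k <;> fin_cases l <;>
    simp [bell, mul_apply, Fintype.sum_prod_type, finProdFinEquiv, diagonal_apply] <;> ring_nf

theorem canonicalGate_swap_edge_locallyEquivalent (x : ℝ) :
    LocallyEquivalent (canonicalGate ![Real.pi / 2, Real.pi / 2, Real.pi / 2 - x])
      (mirror (cphase (2 * x))) := by
  rw [canonicalGate_swap_edge]
  refine LocallyEquivalent.mirror (LocallyEquivalent.trans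
    -- The cross ratio has argument (π/2 - x) - (π/2 + x) = -2x.
    (locallyEquivalent_cphase_of_cross_ratio (θ := -(2 * x)) (fun p => norm_exp_I_mul _) ?_) ?_)
  · simp [← Complex.exp_add]
    ring_nf
  · simpa using cphase_locallyEquivalent_neg (-(2 * x))

theorem weylPoints_cphase {x : ℝ} (hx : x ∈ Set.Icc 0 (Real.pi / 2)) :
    weylPoints (cphase (2 * x)) = {![x, 0, 0]} := by
  rw [← (canonicalGate_cnot_edge_locallyEquivalent x).weylPoints_eq]
  ext c
  refine ⟨fun h => eq_of_locallyEquivalent_canonicalGate_cnot_edge h.1 hx h.2.symm, ?_⟩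
  rintro rfl
  refine ⟨?_, 1, one_mem _, 1, one_mem _, 1, one_mem _, 1, one_mem _, by simp⟩
  obtain ⟨h0, h1⟩ := hx
  have := Real.pi_pos
  refine ⟨?_, ?_, ?_, ?_, fun _ => ?_⟩ <;> simp <;> linarith

theorem weylPoints_mirror_cphase {x : ℝ} (hx : x ∈ Set.Icc 0 (Real.pi / 2)) :
    weylPoints (mirror (cphase (2 * x))) = {![Real.pi / 2, Real.pi / 2, Real.pi / 2 - x]} := by
  rw [← (canonicalGate_swap_edge_locallyEquivalent x).weylPoints_eq]
  ext c
  refine ⟨fun h => eq_of_locallyEquivalent_canonicalGate_swap_edge h.1 hx h.2.symm, ?_⟩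
  rintro rfl
  refine ⟨?_, 1, one_mem _, 1, one_mem _, 1, one_mem _, 1, one_mem _, by simp⟩
  obtain ⟨h0, h1⟩ := hx
  refine ⟨?_, ?_, ?_, ?_, fun _ => ?_⟩ <;> simp <;> linarith

/-! ### Phase carriers -/

/-- The phases on the diagonal of `Z_{θ₀} ⊗ Z_{θ₁}`. -/
def rotZPhase (θ₀ θ₁ : ℝ) (p : Fin 2 × Fin 2) : ℂ :=
  Complex.exp (Complex.I * ((if p.1 = 0 then θ₀ / 2 else -(θ₀ / 2)) +
    (if p.2 = 0 then θ₁ / 2 else -(θ₁ / 2)) : ℝ))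

theorem rotZ_kronecker_rotZ (θ₀ θ₁ : ℝ) :
    rotZ θ₀ ⊗ₖ rotZ θ₁ = diagonal (rotZPhase θ₀ θ₁) := by
  ext ⟨i, j⟩ ⟨k, l⟩
  fin_cases i <;> fin_cases j <;> fin_cases k <;> fin_cases l <;>
    simp [rotZ, rotZPhase, ← Complex.exp_add] <;> ring_nf

theorem rotZPhase_mul_antipode (θ₀ θ₁ : ℝ) (p : Fin 2 × Fin 2) :
    rotZPhase θ₀ θ₁ p * rotZPhase θ₀ θ₁ (p + (1, 1)) = 1 := by
  obtain ⟨i, j⟩ := p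
  fin_cases i <;> fin_cases j <;> simp [rotZPhase, ← Complex.exp_add] <;> ring_nf <;> simp

/-- A pair of rotations whose four phases are distinct. -/
theorem rotZPhase_injective :
    Function.Injective (rotZPhase (5 * Real.pi / 6) (Real.pi / 6)) := by
  have hi : Set.InjOn (fun t : ℝ => Complex.exp (Complex.I * t)) (Set.Ioc (-Real.pi) Real.pi) := by
    intro s hs t ht h
    have h' := congrArg Complex.arg h
    simpa [mul_comm Complex.I, Complex.arg_exp_mul_I,
      (toIocMod_eq_self Real.two_pi_pos).2 (show s ∈ Set.Ioc (-Real.pi) (-Real.pi + 2 * Real.pi)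
        from ⟨hs.1, by linarith [hs.2]⟩),
      (toIocMod_eq_self Real.two_pi_pos).2 (show t ∈ Set.Ioc (-Real.pi) (-Real.pi + 2 * Real.pi)
        from ⟨ht.1, by linarith [ht.2]⟩)] using h'
  have hpi := Real.pi_pos
  rintro ⟨i, j⟩ ⟨k, l⟩ h
  -- The four arguments are ±π/2 and ±π/3.
  have := hi (by constructor <;> split_ifs <;> linarith) (by constructor <;> split_ifs <;> linarith) h
  revert this
  fin_cases i <;> fin_cases j <;> fin_cases k <;> fin_cases l <;> simp <;> intro this <;> linarith

/-- The automorphisms of a square with vertices `Fin 2 × Fin 2`. -/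
theorem eq_add_or_eq_swap_add_of_antipode : ∀ σ : Fin 2 × Fin 2 → Fin 2 × Fin 2,
    Function.Injective σ → (∀ p, σ (p + (1, 1)) = σ p + (1, 1)) →
    (∀ p, σ p = p + σ 0) ∨ ∀ p, σ p = p.swap + σ 0 := by
  intro σ hσ h
  have h1 : σ (1, 1) = σ (0, 0) + (1, 1) := h (0, 0)
  have h2 : σ (1, 0) = σ (0, 1) + (1, 1) := h (0, 1)
  have h3 : σ (0, 1) ≠ σ (0, 0) := fun e => by simpa using hσ e
  have h4 : σ (0, 1) ≠ σ (0, 0) + (1, 1) := fun e => by simpa using hσ (e.trans h1.symm)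
  have key : ∀ a b : Fin 2 × Fin 2, b ≠ a → b ≠ a + (1, 1) → b = (0, 1) + a ∨ b = (1, 0) + a := by
    decide
  have hz : (0 : Fin 2 × Fin 2) = (0, 0) := rfl
  have e1 : ∀ a : Fin 2 × Fin 2, (0, 1) + a + (1, 1) = (1, 0) + a := by decide
  have e2 : ∀ a : Fin 2 × Fin 2, (1, 0) + a + (1, 1) = (0, 1) + a := by decide
  have e3 : ∀ a : Fin 2 × Fin 2, a = (0, 0) + a := by decide
  have e4 : ∀ a : Fin 2 × Fin 2, a + (1, 1) = (1, 1) + a := by decide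
  rw [hz]
  -- The images of (0,0) and (0,1) determine the map, and two choices are left for the latter.
  rcases key _ _ h3 h4 with h5 | h5
  · left
    rintro ⟨i, j⟩
    fin_cases i <;> fin_cases j
    · exact e3 _
    · exact h5
    · exact h2.trans ((congrArg (· + (1, 1)) h5).trans (e1 _))
    · exact h1.trans (e4 _)
  · right
    rintro ⟨i, j⟩
    fin_cases i <;> fin_cases j
    · exact e3 _
    · exact h5
    · exact h2.trans ((congrArg (· + (1, 1)) h5).trans (e2 _))
    · exact h1.trans (e4 _)

/-- A phase carrier is a monomial matrix whose permutation preserves antipodes. -/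
theorem IsPhaseCarrier.exists_monomial {U : Op2} (hU : U ∈ unitaryGroup (Fin 2 × Fin 2) ℂ)
    (h : IsPhaseCarrier U) : ∃ σ : Fin 2 × Fin 2 → Fin 2 × Fin 2, Function.Injective σ ∧
      (∀ p, σ (p + (1, 1)) = σ p + (1, 1)) ∧ ∀ p q, p ≠ σ q → U p q = 0 := by
  obtain ⟨φ₀, φ₁, hφ⟩ := h (5 * Real.pi / 6) (Real.pi / 6)
  rw [rotZ_kronecker_rotZ, rotZ_kronecker_rotZ] at hφ
  set d := rotZPhase (5 * Real.pi / 6) (Real.pi / 6)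
  set d' := rotZPhase φ₀ φ₁
  have hd : Function.Injective d := rotZPhase_injective
  have hcomm : ∀ p q, U p q ≠ 0 → d q = d' p := by
    intro p q hpq
    have := congrFun (congrFun hφ p) q
    rw [mul_diagonal, diagonal_mul, mul_comm] at this
    exact mul_right_cancel₀ hpq this
  have hex : ∀ q, ∃ p, U p q ≠ 0 := by
    intro q
    by_contra! hq
    have := congrFun (congrFun (mem_unitaryGroup_iff'.1 hU) q) q
    simp [mul_apply, hq] at this
  choose σ hσ using hex
  have hdσ : ∀ q, d q = d' (σ q) := fun q => hcomm _ _ (hσ q)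
  have hinj : Function.Injective σ := fun a b hab => hd (by rw [hdσ, hdσ, hab])
  refine ⟨σ, hinj, fun p => ?_, fun p q hpq => ?_⟩
  -- The column r sent to the antipode of σ p carries the phase inverse to that of p; distinctness
  -- of phases makes r the antipode of p.
  · obtain ⟨r, hr⟩ := (Finite.injective_iff_surjective.1 hinj) (σ p + (1, 1))
    have h1 : d p * d r = 1 := by
      rw [hdσ, hdσ, hr]
      exact rotZPhase_mul_antipode _ _ _
    have h2 : d p * d (p + (1, 1)) = 1 := rotZPhase_mul_antipode _ _ _
    rw [← hr, hd (mul_left_cancel₀ (left_ne_zero_of_mul_eq_one h1) (h1.trans h2.symm))]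
  · by_contra hne
    obtain ⟨r, rfl⟩ := (Finite.injective_iff_surjective.1 hinj) p
    exact hpq (congrArg σ (hd ((hdσ r).trans (hcomm _ _ hne).symm)))

/-- `X^a` for `a : Fin 2`. -/
def pauliXPow (a : Fin 2) : Op1 := Matrix.of fun i j => if i = j + a then 1 else 0

theorem pauliXPow_mem_unitaryGroup (a : Fin 2) : pauliXPow a ∈ unitaryGroup (Fin 2) ℂ := by
  rw [mem_unitaryGroup_iff]
  ext i j
  fin_cases a <;> fin_cases i <;> fin_cases j <;> simp [pauliXPow, mul_apply, star_apply]

theorem pauliXPow_kronecker_mul_apply (a p q : Fin 2 × Fin 2) (V : Op2) :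
    ((pauliXPow a.1 ⊗ₖ pauliXPow a.2) * V) p q = V (p + a) q := by
  obtain ⟨a, b⟩ := a
  obtain ⟨i, j⟩ := p
  fin_cases a <;> fin_cases b <;> fin_cases i <;> fin_cases j <;>
    simp [pauliXPow, mul_apply, Fintype.sum_prod_type]

theorem locallyEquivalent_pauliXPow_mul (a : Fin 2 × Fin 2) (V : Op2) :
    LocallyEquivalent ((pauliXPow a.1 ⊗ₖ pauliXPow a.2) * V) V :=
  ⟨_, pauliXPow_mem_unitaryGroup a.1, _, pauliXPow_mem_unitaryGroup a.2, 1, one_mem _,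
    1, one_mem _, by simp⟩

theorem norm_entry_eq_one_of_monomial {n : Type*} [Fintype n] [DecidableEq n] {U : Matrix n n ℂ}
    (hU : U ∈ unitaryGroup n ℂ) {p q : n} (h : ∀ r, r ≠ p → U r q = 0) : ‖U p q‖ = 1 := by
  have := congrFun (congrFun (mem_unitaryGroup_iff'.1 hU) q) q
  rw [mul_apply, Finset.sum_eq_single p (fun r _ hr => by simp [h r hr]) (by simp), one_apply_eq,
    star_apply, RCLike.star_def, Complex.conj_mul'] at this
  have h2 : ‖U p q‖ ^ 2 = 1 := by exact_mod_cast this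
  exact (pow_eq_one_iff_of_nonneg (norm_nonneg _) two_ne_zero).1 h2

theorem IsPhaseCarrier.locallyEquivalent {U : Op2} (hU : U ∈ unitaryGroup (Fin 2 × Fin 2) ℂ)
    (h : IsPhaseCarrier U) : (∃ θ, LocallyEquivalent U (cphase θ)) ∨
      ∃ θ, LocallyEquivalent U (mirror (cphase θ)) := by
  obtain ⟨σ, hinj, hanti, hz⟩ := h.exists_monomial hU
  have hadd : ∀ a b : Fin 2 × Fin 2, a + b + b = a := by decide
  have hn : ∀ q, ‖U (σ q) q‖ = 1 := fun q =>
    norm_entry_eq_one_of_monomial hU fun r hr => hz r q hr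
  -- Flipping by σ 0 removes the translation part of σ, leaving a diagonal gate or SWAP times one.
  have hUW := (locallyEquivalent_pauliXPow_mul (σ 0) U).symm
  obtain ⟨θ, hθ⟩ := exists_locallyEquivalent_cphase hn
  rcases eq_add_or_eq_swap_add_of_antipode σ hinj hanti with hσ | hσ
  · refine .inl ⟨θ, hUW.trans ?_⟩
    convert hθ using 1
    ext p q
    rw [pauliXPow_kronecker_mul_apply, diagonal_apply]
    split_ifs with hpq
    · rw [hpq, hσ q]
    · exact hz _ _ fun e => hpq (add_right_cancel (e.trans (hσ q)))
  · refine .inr ⟨θ, hUW.trans ?_⟩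
    convert hθ.mirror using 1
    ext p q
    rw [pauliXPow_kronecker_mul_apply, mirror, swapGate_mul_apply, diagonal_apply]
    split_ifs with hpq
    · rw [← hpq, hσ p.swap, Prod.swap_swap]
    · refine hz _ _ fun e => hpq ?_
      rw [add_right_cancel (e.trans (hσ q)), Prod.swap_swap]

/-! ### The endpoints -/

theorem cphase_zero : cphase 0 = 1 := by
  simp [cphase]

/-- Hadamard conjugation on the target turns the controlled Z into a controlled X. -/
theorem cnotGate_locallyEquivalent : LocallyEquivalent cnotGate (cphase Real.pi) := by
  refine ⟨1, one_mem _, hadamard, hadamard_mem_unitaryGroup, 1, one_mem _,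
    hadamard, hadamard_mem_unitaryGroup, ?_⟩
  have hpi : Complex.exp (Complex.I * Real.pi) = -1 := by rw [mul_comm, Complex.exp_pi_mul_I]
  ext ⟨i, j⟩ ⟨k, l⟩
  fin_cases i <;> fin_cases j <;> fin_cases k <;> fin_cases l <;>
    simp [cnotGate, cphase, hadamard, mul_apply, Fintype.sum_prod_type, diagonal_apply, one_apply,
      hpi, inv_sqrt_two_mul_self] <;> norm_num

/-- The diagonal factor (1, i, i, 1) has cross ratio 1/i² = -1. -/
theorem iswapGate_locallyEquivalent : LocallyEquivalent iswapGate (mirror (cphase Real.pi)) := by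
  have h : iswapGate = mirror (diagonal fun p => if p.1 = p.2 then 1 else Complex.I) := by
    ext ⟨i, j⟩ ⟨k, l⟩
    rw [mirror, swapGate_mul_apply]
    fin_cases i <;> fin_cases j <;> fin_cases k <;> fin_cases l <;>
      simp [iswapGate]
  rw [h]
  refine (locallyEquivalent_cphase_of_cross_ratio (fun p => ?_) ?_).mirror
  · split_ifs <;> simp
  · simp [mul_comm Complex.I, Complex.exp_pi_mul_I]

end TwoQubit

end

theorem mainTheorem3 :
    -- the four endpoints of the two segments
    (TwoQubit.weylPoints 1 = {![0, 0, 0]} ∧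
      TwoQubit.weylPoints TwoQubit.cnotGate = {![Real.pi / 2, 0, 0]} ∧
      TwoQubit.weylPoints TwoQubit.iswapGate = {![Real.pi / 2, Real.pi / 2, 0]} ∧
      TwoQubit.weylPoints TwoQubit.swapGate = {![Real.pi / 2, Real.pi / 2, Real.pi / 2]}) ∧
    ∀ U : TwoQubit.Op2, U ∈ Matrix.unitaryGroup (Fin 2 × Fin 2) ℂ → TwoQubit.IsPhaseCarrier U →
      ((∃ θ : ℝ, TwoQubit.LocallyEquivalent U (TwoQubit.cphase θ)) ∧
        ∃ x ∈ Set.Icc (0 : ℝ) (Real.pi / 2), TwoQubit.weylPoints U = {![x, 0, 0]}) ∨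
      ((∃ θ : ℝ, TwoQubit.LocallyEquivalent U (TwoQubit.mirror (TwoQubit.cphase θ))) ∧
        ∃ x ∈ Set.Icc (0 : ℝ) (Real.pi / 2),
          TwoQubit.weylPoints U = {![Real.pi / 2, Real.pi / 2, Real.pi / 2 - x]}) := by
  open TwoQubit in
  have hpi := Real.pi_pos
  have m0 : (0 : ℝ) ∈ Set.Icc 0 (Real.pi / 2) := ⟨le_rfl, by linarith⟩
  have m1 : Real.pi / 2 ∈ Set.Icc 0 (Real.pi / 2) := ⟨by linarith, le_rfl⟩
  refine ⟨⟨?_, ?_, ?_, ?_⟩, fun U hU hc => ?_⟩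
  · simpa [cphase_zero] using weylPoints_cphase m0
  · rw [cnotGate_locallyEquivalent.weylPoints_eq]
    simpa [mul_div_cancel₀] using weylPoints_cphase m1
  · rw [iswapGate_locallyEquivalent.weylPoints_eq]
    simpa [mul_div_cancel₀] using weylPoints_mirror_cphase m1
  · simpa [cphase_zero, mirror] using weylPoints_mirror_cphase m0
  · rcases hc.locallyEquivalent hU with ⟨θ, h⟩ | ⟨θ, h⟩ <;>
      obtain ⟨x, hx, hx'⟩ := exists_cphase_locallyEquivalent θ
    · exact .inl ⟨⟨θ, h⟩, x, hx, by rw [(h.trans hx').weylPoints_eq, weylPoints_cphase hx]⟩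
    · exact .inr ⟨⟨θ, h⟩, x, hx,
        by rw [(h.trans hx'.mirror).weylPoints_eq, weylPoints_mirror_cphase hx]⟩
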